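/- Let $m\ge 1$. An $m$-ballot path of size $n$ is a lattice path from $(0,0)$ to $(mn,n)$ with steps $(0,1)$ (written $1$) and $(1,0)$ (written $0$) that stays weakly above the line $y=x/m$; it is primitive if it is nonempty and meets this line only at its two endpoints. A rotation of an $m$-ballot path exchanges a step $0$ with a primitive $m$-ballot path $c$ (up to translation) that immediately follows it (that is, $a\,0\,c\,b\mapsto a\,c\,0\,b$). The $m$-Tamari order on $m$-ballot paths of size $n$ is defined by $P\le Q$ if $Q$ is obtained from $P$ by a (possibly empty) sequence of rotations. Let $$\Phi^{(m)}(x,y)=\sum_{n\ge 0}\ \sum_{[P,Q]} x^{c(P)}y^{n}\in\mathbb Z[x][[y]]$$ be the generating function of $m$-Tamari intervals, where the inner sum is over pairs $P\le Q$ of $m$-ballot paths of size $n$, and $c(P)$ is the number of contacts of the lower path $P$ with the line $y=x/m$ after the origin. Then $$\Phi^{(m)}=B^{(m)}(\Phi^{(m)},\dots,\Phi^{(m)})+1,$$ where, with $f\succ g:=fg$, $\ f\prec_\delta g:=f\,\Delta(g)$ and $\Delta(g):=\dfrac{x\,g(x,y)-g(1,y)}{x-1}$, the $(m+1)$-linear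 operator $B^{(m)}$ is $$B^{(m)}(f,g_1,\dots,g_m)=f\succ xy\prec_\delta\bigl(g_1\prec_\delta(\cdots\prec_\delta(g_{m-1}\prec_\delta g_m))\cdots\bigr)=xy\,f\,\Delta\bigl(g_1\,\Delta(g_2\,\Delta(\cdots\Delta(g_m)\cdots))\bigr).$$ -/

import Mathlib

open Polynomial in
/-- The divided difference of a polynomial in `x`: the quotient `(x p(x) - p(1)) / (x - 1)`.
The division is exact, see `MTamari.sub_one_mul_polyDelta`. -/
noncomputable def MTamari.polyDelta (p : ℤ[X]) : ℤ[X] :=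
  (X * p - C (p.eval 1)) /ₘ (X - C 1)

open Polynomial in
theorem MTamari.sub_one_mul_polyDelta (p : ℤ[X]) :
    (X - 1) * MTamari.polyDelta p = X * p - C (p.eval 1) := by
  have h : (X * p - C (p.eval 1)).IsRoot (1 : ℤ) := by simp
  simpa [MTamari.polyDelta] using Polynomial.mul_divByMonic_eq_iff_isRoot.2 h

namespace MTamari

/-! ### Paths

A path is a word on `{1, 0}`, coded by booleans: `true` is the up step `(0, 1)` and `false` is the
step `(1, 0)`. After the prefix `w` the path is at the point `(w.count false, w.count true)`. -/

/-- `w` is an `m`-ballot path of size `n`: it goes from `(0, 0)` to `(m n, n)` and all its points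
`(a, b)` satisfy `b ≥ a / m`. -/
def IsBallotPath (m n : ℕ) (w : List Bool) : Prop :=
  w.count true = n ∧ w.count false = m * n ∧
    ∀ k ≤ w.length, (w.take k).count false ≤ m * (w.take k).count true

/-- After `k` steps the path `w` is on the line `y = x / m`. -/
def TouchesAt (m : ℕ) (w : List Bool) (k : ℕ) : Prop :=
  (w.take k).count false = m * (w.take k).count true

instance (m : ℕ) (w : List Bool) (k : ℕ) : Decidable (TouchesAt m w k) :=
  inferInstanceAs (Decidable (_ = _))

/-- The number of contacts of `w` with the line `y = x / m` after the origin. -/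
def contacts (m : ℕ) (w : List Bool) : ℕ :=
  ((Finset.Icc 1 w.length).filter fun k => TouchesAt m w k).card

/-- `c` is a primitive `m`-ballot path: it is nonempty, and its only contacts with the line
`y = x / m` are its two endpoints. -/
def IsPrimitive (m : ℕ) (c : List Bool) : Prop :=
  c ≠ [] ∧ (∃ n, IsBallotPath m n c) ∧ ∀ k, 0 < k → k < c.length → ¬ TouchesAt m c k

/-- The type of `m`-ballot paths of size `n`. -/
def BallotPath (m n : ℕ) : Type := {w : List Bool // IsBallotPath m n w}

instance (m n : ℕ) : Finite (BallotPath m n) := by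
  refine Set.Finite.to_subtype (s := {w | IsBallotPath m n w})
    ((List.finite_length_eq Bool (n + m * n)).subset ?_)
  rintro w ⟨h1, h2, -⟩
  simp only [Set.mem_ofPred_eq]
  rw [← List.count_true_add_count_false (l := w), h1, h2]

/-- `q` is obtained from `p` by a rotation: a step `0` of `p` followed by a primitive path `c` is
exchanged with `c`. -/
def Rotation {m n : ℕ} (p q : BallotPath m n) : Prop :=
  ∃ a c b : List Bool, IsPrimitive m c ∧
    p.1 = a ++ [false] ++ c ++ b ∧ q.1 = a ++ c ++ [false] ++ b

theorem Rotation.lt {m n : ℕ} {p q : BallotPath m n} (h : Rotation p q) : p.1 < q.1 := by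
  obtain ⟨a, c, b, ⟨hc, ⟨k, -, -, hb⟩, -⟩, hp, hq⟩ := h
  rw [hp, hq]
  cases c with
  | nil => exact absurd rfl hc
  | cons x c =>
    cases x with
    | false => simpa using hb 1 (by simp)
    | true =>
      simp only [List.append_assoc, List.cons_append, List.nil_append]
      exact List.append_left_lt (List.Lex.rel (by decide))

/-- The `m`-Tamari order on `m`-ballot paths of size `n`: `p ≤ q` when `q` can be reached from `p`
by a (possibly empty) sequence of rotations. -/
instance (m n : ℕ) : PartialOrder (BallotPath m n) where
  le := Relation.ReflTransGen Rotation
  le_refl _ := Relation.ReflTransGen.refl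
  le_trans _ _ _ := Relation.ReflTransGen.trans
  le_antisymm p q hpq hqp := by
    have key : ∀ {p q : BallotPath m n}, Relation.ReflTransGen Rotation p q → p.1 ≤ q.1 := by
      intro p q h
      induction h with
      | refl => exact le_refl _
      | tail _ h ih => exact ih.trans h.lt.le
    exact Subtype.ext (le_antisymm (key hpq) (key hqp))

/-- The intervals `[p, q]` of the `m`-Tamari order on paths of size `n`, as pairs `p ≤ q`. -/
def TamariInterval (m n : ℕ) : Type := {I : BallotPath m n × BallotPath m n // I.1 ≤ I.2}

instance (m n : ℕ) : Finite (TamariInterval m n) := Subtype.finite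

noncomputable instance (m n : ℕ) : Fintype (TamariInterval m n) := Fintype.ofFinite _

/-! ### Series

Series in `x` and `y` are power series in `y` whose coefficients are polynomials in `x`. -/

/-- The ring `ℤ[x][[y]]`. -/
abbrev Series : Type := PowerSeries (Polynomial ℤ)

/-- The variable `x`. -/
noncomputable def x : Series := PowerSeries.C Polynomial.X

/-- The variable `y`. -/
noncomputable def y : Series := PowerSeries.X

/-- The generating function of `m`-Tamari intervals: `y` marks the size of the paths and `x` marks
the number of contacts of the lower path. -/
noncomputable def intervalSeries (m : ℕ) : Series :=
  PowerSeries.mk fun n => ∑ I : TamariInterval m n, Polynomial.X ^ contacts m I.1.1.1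

/-- The specialization `g(1, y)`. -/
noncomputable def atOne (g : Series) : Series :=
  PowerSeries.map (Polynomial.C.comp (Polynomial.evalRingHom 1)) g

/-- `Δ(g) = (x g(x, y) - g(1, y)) / (x - 1)`, computed on each coefficient. It is the only series
with the property `sub_one_mul_delta`. -/
noncomputable def delta (g : Series) : Series :=
  PowerSeries.mk fun n => polyDelta (PowerSeries.coeff n g)

theorem sub_one_mul_delta (g : Series) : (x - 1) * delta g = x * g - atOne g := by
  have h : (x - 1 : Series) = PowerSeries.C (Polynomial.X - 1) := by simp [x]
  ext1 n
  rw [h, PowerSeries.coeff_C_mul]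
  simp [delta, sub_one_mul_polyDelta, atOne, x, PowerSeries.coeff_C_mul]

/-- The left product `f ≻ g`. -/
noncomputable def leftProd (f g : Series) : Series := f * g

/-- The right product `f ≺_δ g`. -/
noncomputable def rightProd (f g : Series) : Series := f * delta g

/-- `g₁ ≺_δ (g₂ ≺_δ (⋯ ≺_δ (gₘ₋₁ ≺_δ gₘ)))` for the list `[g₁, …, gₘ]` (the value for the empty list
plays no role). -/
noncomputable def iterRightProd : List Series → Series
  | [] => 1
  | [g] => g
  | g :: h :: l => rightProd g (iterRightProd (h :: l))

/-- The operator `B⁽ᵐ⁾(f, g₁, …, gₘ) = f ≻ xy ≺_δ (g₁ ≺_δ (⋯ ≺_δ (gₘ₋₁ ≺_δ gₘ)))`. -/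
noncomputable def opB {m : ℕ} (f : Series) (g : Fin m → Series) : Series :=
  leftProd f (rightProd (x * y) (iterRightProd (List.ofFn g)))

theorem polyDelta_add (p q : Polynomial ℤ) : polyDelta (p + q) = polyDelta p + polyDelta q := by
  have h : (Polynomial.X - 1 : Polynomial ℤ) ≠ 0 := Polynomial.X_sub_C_ne_zero 1
  apply mul_left_cancel₀ h
  rw [mul_add, sub_one_mul_polyDelta, sub_one_mul_polyDelta, sub_one_mul_polyDelta,
    Polynomial.eval_add, Polynomial.C_add]
  ring

theorem delta_add (f g : Series) : delta (f + g) = delta f + delta g := by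
  ext1 n
  simp [delta, polyDelta_add]

/-- The operator `B⁽ᵐ⁾` is `m + 1`-linear. -/
theorem opB_multilinear (m : ℕ) (hm : 1 ≤ m) :
    ∃ B : MultilinearMap ℤ (fun _ : Fin (m + 1) => Series) Series,
      ∀ (f : Series) (g : Fin m → Series), B (Fin.cons f g) = opB f g := by
  let D : Series →ₗ[ℤ] Series := (AddMonoidHom.mk' delta delta_add).toIntLinearMap
  let P (k : ℕ) (E : MultilinearMap ℤ (fun _ : Fin k => Series) Series) :
      MultilinearMap ℤ (fun _ : Fin (k + 1) => Series) Series :=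
    LinearMap.uncurryLeft (M := fun _ : Fin (k + 1) => Series)
      { toFun := fun f => ((LinearMap.mulLeft ℤ f).comp D).compMultilinearMap E
        map_add' := fun f g => by ext v; simp [add_mul]
        map_smul' := fun a f => by ext v; simp }
  have hP : ∀ k E v, P k E v = v 0 * delta (E (Fin.tail v)) := fun k E v => rfl
  have key : ∀ k, ∃ E : MultilinearMap ℤ (fun _ : Fin (k + 1) => Series) Series,
      ∀ v, E v = iterRightProd (List.ofFn v) := by
    intro k
    induction k with
    | zero =>
      refine ⟨MultilinearMap.mk' (fun v => v 0) ?_ ?_, fun v => by simp [iterRightProd]⟩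
      · intro v i a b
        obtain rfl : i = 0 := Fin.fin_one_eq_zero i
        simp
      · intro v i a b
        obtain rfl : i = 0 := Fin.fin_one_eq_zero i
        simp
    | succ k ih =>
      obtain ⟨E, hE⟩ := ih
      refine ⟨P _ E, fun v => ?_⟩
      rw [hP, hE]
      simp [iterRightProd, rightProd, List.ofFn_succ, Fin.tail]
  obtain ⟨k, rfl⟩ : ∃ k, m = k + 1 := ⟨m - 1, by lia⟩
  obtain ⟨E, hE⟩ := key k
  refine ⟨(LinearMap.mulLeft ℤ (x * y)).compMultilinearMap (P _ E), fun f g => ?_⟩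
  rw [LinearMap.compMultilinearMap_apply, hP, hE]
  simp only [LinearMap.mulLeft_apply, Fin.cons_zero, Fin.tail_cons, opB, leftProd, rightProd]
  ring

end MTamari

/-! Put the point `(a, b)` at level `m b - a`, and let `F_j` be the series of pairs `v ≤ w` of words
read from level `j`, staying at nonnegative levels and ending at level `0`; thus `Φ = F_0`. Every
nonempty ballot path starts with a step `1`, which no rotation moves, so `F_0 = x y F_m + 1`
(`levelSeries_zero`). It remains to show `F_{j+1} = F_0 Δ(F_j)` (`levelSeries_succ`), since
iterating this from `F_0` up to `F_m` produces the nested products of `B⁽ᵐ⁾`.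

Cut the upper path at its first visit of level `0`, as `u 0 v`. The lower path also visits level `0`
where the upper one does (`WordLE.exists_append`), so it is a lower path for `u 0` followed by some
`t ≤ v`; the pair `(t, v)` gives the factor `F_0`. Write the lower path for `u 0` as `r 0 s`, cut at
its own first visit. Then `r 0 s ≤ u 0` exactly when `r s ≤ u` (`wordLE_append_false_iff`), so what
remains is a pair counted by `F_j` with a marked visit of level `0` on its lower path. If that path
has `c` contacts, the suffixes `s` have `0, 1, …, c` contacts, which gives `1 + x + ⋯ + x^c =
Δ(x^c)` (`PathFrom.sum_cuts`). -/

namespace MTamari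

/-! ### Paths from a given level

The level of the point `(a, b)` is `m b - a`: an up step adds `m` to the level, and the other step
subtracts `1`. -/

/-- The word `w`, read from level `j`, stays at nonnegative levels and ends at level `0`. -/
def PathFrom (m : ℕ) : ℕ → List Bool → Prop
  | j, [] => j = 0
  | j, true :: w => PathFrom m (j + m) w
  | 0, false :: _ => False
  | j + 1, false :: w => PathFrom m j w

/-- The number of visits of level `0` by the path `w` from level `j`, its last point excluded. -/
def levelContacts (m : ℕ) : ℕ → List Bool → ℕ
  | _, [] => 0
  | j, true :: w => (if j = 0 then 1 else 0) + levelContacts m (j + m) w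
  | j, false :: w => (if j = 0 then 1 else 0) + levelContacts m (j - 1) w

section Paths

variable {m : ℕ}

@[simp] theorem pathFrom_nil {j : ℕ} : PathFrom m j [] ↔ j = 0 := by
  simp [PathFrom]

@[simp] theorem pathFrom_true_cons {j : ℕ} {w : List Bool} :
    PathFrom m j (true :: w) ↔ PathFrom m (j + m) w := by
  cases j <;> simp [PathFrom]

@[simp] theorem not_pathFrom_zero_false_cons {w : List Bool} : ¬ PathFrom m 0 (false :: w) := by
  simp [PathFrom]

@[simp] theorem pathFrom_succ_false_cons {j : ℕ} {w : List Bool} :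
    PathFrom m (j + 1) (false :: w) ↔ PathFrom m j w := by
  simp [PathFrom]

theorem PathFrom.count_false {j : ℕ} {w : List Bool} (h : PathFrom m j w) :
    w.count false = j + m * w.count true := by
  induction w generalizing j with
  | nil => simp_all
  | cons b w ih =>
    cases b with
    | true =>
      have := ih (pathFrom_true_cons.1 h)
      simp only [List.count_cons]
      simp [this]
      ring
    | false =>
      cases j with
      | zero => simp at h
      | succ j =>
        have := ih (pathFrom_succ_false_cons.1 h)
        simp only [List.count_cons]
        simp [this]
        ring

/-- The numbers of steps of each kind determine the starting level. -/
theorem PathFrom.level_unique {i j : ℕ} {w : List Bool} (hi : PathFrom m i w)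
    (hj : PathFrom m j w) : i = j := by
  have := hi.count_false
  have := hj.count_false
  lia

theorem PathFrom.append_iff {s i : ℕ} {c w : List Bool} (hc : PathFrom m s c) :
    PathFrom m (s + i) (c ++ w) ↔ PathFrom m i w := by
  induction c generalizing s with
  | nil => simp_all
  | cons b c ih =>
    cases b with
    | true =>
      rw [← ih (pathFrom_true_cons.1 hc), List.cons_append, pathFrom_true_cons, add_right_comm]
    | false =>
      cases s with
      | zero => simp at hc
      | succ s =>
        rw [← ih (pathFrom_succ_false_cons.1 hc), List.cons_append, add_right_comm,
          pathFrom_succ_false_cons]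

theorem PathFrom.append_iff_of_zero {i : ℕ} {c w : List Bool} (hc : PathFrom m 0 c) :
    PathFrom m i (c ++ w) ↔ PathFrom m i w := by
  simpa using hc.append_iff (i := i) (w := w)

theorem PathFrom.append_zero_iff {s : ℕ} {c w : List Bool} (hc : PathFrom m s c) :
    PathFrom m s (c ++ w) ↔ PathFrom m 0 w :=
  hc.append_iff (i := 0)

theorem PathFrom.of_append {s : ℕ} {c w : List Bool} (h : PathFrom m s (c ++ w))
    (hw : PathFrom m 0 w) : PathFrom m s c := by
  induction c generalizing s with
  | nil => exact pathFrom_nil.2 (PathFrom.level_unique h hw)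
  | cons b c ih =>
    cases b with
    | true => exact pathFrom_true_cons.2 (ih (by simpa using h))
    | false =>
      cases s with
      | zero => simp at h
      | succ s => exact pathFrom_succ_false_cons.2 (ih (by simpa using h))

/-- A path from a positive level is cut by its first visit of level `0`. -/
theorem PathFrom.exists_first_visit {j : ℕ} {w : List Bool} (h : PathFrom m (j + 1) w) :
    ∃ u v, w = u ++ false :: v ∧ PathFrom m j u ∧ PathFrom m 0 v := by
  induction w generalizing j with
  | nil => simp at h
  | cons b w ih =>
    cases b with
    | true =>
      rw [pathFrom_true_cons, add_right_comm] at h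
      obtain ⟨u, v, rfl, hu, hv⟩ := ih h
      exact ⟨true :: u, v, rfl, pathFrom_true_cons.2 hu, hv⟩
    | false =>
      rw [pathFrom_succ_false_cons] at h
      cases j with
      | zero => exact ⟨[], w, rfl, by simp, h⟩
      | succ j =>
        obtain ⟨u, v, rfl, hu, hv⟩ := ih h
        exact ⟨false :: u, v, rfl, pathFrom_succ_false_cons.2 hu, hv⟩

/-- The converse of `PathFrom.exists_first_visit`. -/
theorem PathFrom.append_false {j : ℕ} {u v : List Bool} (hu : PathFrom m j u)
    (hv : PathFrom m 0 v) : PathFrom m (j + 1) (u ++ false :: v) :=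
  hu.append_iff.2 (by simpa using hv)

/-- A path that is read from level `i + s` and then followed by a step `0` cannot end inside a path
that goes from level `i + s` to level `i` staying weakly above this level. -/
theorem PathFrom.exists_eq_append {s i : ℕ} {c d u v : List Bool} (hc : PathFrom m s c)
    (hu : PathFrom m (s + i) u) (h : u ++ false :: v = c ++ d) :
    ∃ u', u = c ++ u' ∧ PathFrom m i u' ∧ d = u' ++ false :: v := by
  induction c generalizing s u with
  | nil =>
    obtain rfl : s = 0 := by simpa using hc
    exact ⟨u, rfl, by simpa using hu, h.symm⟩
  | cons b c ih =>
    cases u with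
    | nil =>
      -- If `u` is empty, `c` would begin with a step `0` from relative level `0`.
      obtain ⟨rfl, -⟩ : s = 0 ∧ i = 0 := by simpa using hu
      obtain ⟨rfl, -⟩ : false = b ∧ _ := by simpa using h
      simp at hc
    | cons b' u =>
      obtain ⟨rfl, h₁⟩ : b' = b ∧ u ++ false :: v = c ++ d := by simpa using h
      cases b' with
      | true =>
        rw [pathFrom_true_cons] at hc
        rw [pathFrom_true_cons, add_right_comm] at hu
        obtain ⟨u', rfl, h'⟩ := ih hc hu h₁
        exact ⟨u', rfl, h'⟩
      | false =>
        cases s with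
        | zero => simp at hc
        | succ s =>
          rw [pathFrom_succ_false_cons] at hc
          rw [add_right_comm, pathFrom_succ_false_cons] at hu
          obtain ⟨u', rfl, h'⟩ := ih hc hu h₁
          exact ⟨u', rfl, h'⟩

theorem PathFrom.first_visit_unique {j : ℕ} {u v u' v' : List Bool} (hu : PathFrom m j u)
    (hu' : PathFrom m j u') (h : u ++ false :: v = u' ++ false :: v') : u = u' ∧ v = v' := by
  obtain ⟨t, rfl, ht, h'⟩ := PathFrom.exists_eq_append (i := 0) hu' hu h
  cases t with
  | nil => simpa using h'.symm
  | cons b t =>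
    obtain ⟨rfl, -⟩ : false = b ∧ _ := by simpa using h'
    simp at ht

theorem levelContacts_append {j : ℕ} {u v : List Bool} (hu : PathFrom m j u) :
    levelContacts m j (u ++ v) = levelContacts m j u + levelContacts m 0 v := by
  induction u generalizing j with
  | nil => simp_all [levelContacts]
  | cons b u ih =>
    cases b with
    | true => simp [levelContacts, ih (pathFrom_true_cons.1 hu), add_assoc]
    | false =>
      cases j with
      | zero => simp at hu
      | succ j => simp [levelContacts, ih (pathFrom_succ_false_cons.1 hu)]

theorem levelContacts_first_visit {j : ℕ} {u v : List Bool} (hu : PathFrom m j u) :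
    levelContacts m (j + 1) (u ++ false :: v) = levelContacts m 0 v := by
  induction u generalizing j with
  | nil =>
    obtain rfl : j = 0 := by simpa using hu
    simp [levelContacts]
  | cons b u ih =>
    cases b with
    | true =>
      have := ih (pathFrom_true_cons.1 hu)
      rw [add_right_comm] at this
      simp [levelContacts, this]
    | false =>
      cases j with
      | zero => simp at hu
      | succ j => simp [levelContacts, ih (pathFrom_succ_false_cons.1 hu)]

end Paths

/-! ### The order on words -/

/-- A step `0` moves to the right of the ballot path, possibly empty and possibly not primitive,
that follows it. -/
inductive Slide (m : ℕ) : List Bool → List Bool → Prop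
  | swap (c b : List Bool) (hc : PathFrom m 0 c) : Slide m (false :: (c ++ b)) (c ++ false :: b)
  | cons (x : Bool) {v w : List Bool} (h : Slide m v w) : Slide m (x :: v) (x :: w)

/-- The reflexive and transitive closure of `Slide`. -/
def WordLE (m : ℕ) : List Bool → List Bool → Prop :=
  Relation.ReflTransGen (Slide m)

section Order

variable {m : ℕ}

theorem Slide.append_left {v w : List Bool} (a : List Bool) (h : Slide m v w) :
    Slide m (a ++ v) (a ++ w) := by
  induction a with
  | nil => exact h
  | cons x a ih => exact .cons x ih

theorem Slide.append_right {v w : List Bool} (h : Slide m v w) (b : List Bool) :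
    Slide m (v ++ b) (w ++ b) := by
  induction h with
  | swap c d hc => simpa using Slide.swap c (d ++ b) hc
  | cons x _ ih => exact .cons x ih

theorem Slide.exists_eq {v w : List Bool} (h : Slide m v w) :
    ∃ a c b, PathFrom m 0 c ∧ v = a ++ [false] ++ c ++ b ∧ w = a ++ c ++ [false] ++ b := by
  induction h with
  | swap c b hc => exact ⟨[], c, b, hc, by simp, by simp⟩
  | cons x _ ih =>
    obtain ⟨a, c, b, hc, rfl, rfl⟩ := ih
    exact ⟨x :: a, c, b, hc, by simp, by simp⟩

theorem Slide.perm {v w : List Bool} (h : Slide m v w) : v.Perm w := by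
  induction h with
  | swap c b hc => exact List.perm_middle.symm
  | cons x _ ih => exact ih.cons x

theorem Slide.pathFrom {j : ℕ} {v w : List Bool} (h : Slide m v w) (hv : PathFrom m j v) :
    PathFrom m j w := by
  induction h generalizing j with
  | swap c b hc =>
    cases j with
    | zero => simp at hv
    | succ j =>
      rw [pathFrom_succ_false_cons, hc.append_iff_of_zero] at hv
      rwa [hc.append_iff_of_zero, pathFrom_succ_false_cons]
  | cons x _ ih =>
    cases x with
    | true => exact pathFrom_true_cons.2 (ih (pathFrom_true_cons.1 hv))
    | false =>
      cases j with
      | zero => simp at hv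
      | succ j => exact pathFrom_succ_false_cons.2 (ih (pathFrom_succ_false_cons.1 hv))

namespace WordLE

theorem append {v w v' w' : List Bool} (h : WordLE m v w) (h' : WordLE m v' w') :
    WordLE m (v ++ v') (w ++ w') :=
  Relation.ReflTransGen.trans (h.lift (· ++ v') fun _ _ h => h.append_right v')
    (h'.lift (w ++ ·) fun _ _ h => h.append_left w)

theorem cons {v w : List Bool} (x : Bool) (h : WordLE m v w) : WordLE m (x :: v) (x :: w) :=
  append (v := [x]) .refl h

theorem perm {v w : List Bool} (h : WordLE m v w) : v.Perm w := by
  induction h with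
  | refl => exact .refl _
  | tail _ h ih => exact ih.trans h.perm

theorem pathFrom {j : ℕ} {v w : List Bool} (h : WordLE m v w) (hv : PathFrom m j v) :
    PathFrom m j w := by
  induction h with
  | refl => exact hv
  | tail _ h ih => exact h.pathFrom ih

/-- A slide moves a step `0` to the right past a word that stays weakly above its starting level, so
an initial step `1` never moves. -/
theorem exists_of_true_cons {v w : List Bool} (h : WordLE m (true :: v) w) :
    ∃ w', w = true :: w' ∧ WordLE m v w' := by
  induction h with
  | refl => exact ⟨v, rfl, .refl⟩
  | tail _ h ih =>
    obtain ⟨u, rfl, hu⟩ := ih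
    cases h with
    | cons _ h => exact ⟨_, rfl, hu.tail h⟩

end WordLE

/-- A lower path visits level `0` wherever an upper path does. -/
theorem Slide.exists_append {j : ℕ} {p q q₁ q₂ : List Bool} (h : Slide m p q)
    (hp : PathFrom m j p) (hq : q = q₁ ++ q₂) (hq₁ : PathFrom m j q₁) :
    ∃ p₁ p₂, p = p₁ ++ p₂ ∧ WordLE m p₁ q₁ ∧ WordLE m p₂ q₂ ∧ PathFrom m j p₁ := by
  induction h generalizing j q₁ with
  | swap c b hc =>
    cases j with
    | zero => simp at hp
    | succ j =>
      -- Within `c` the upper path is at positive levels, so `q₁` ends after the moved step `0`: the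
      -- whole slide happens inside `q₁`.
      obtain ⟨u, v, rfl, hu, hv⟩ := hq₁.exists_first_visit
      obtain ⟨u', rfl, hu', h⟩ := hc.exists_eq_append (i := j) (by simpa using hu)
        (show u ++ false :: (v ++ q₂) = c ++ false :: b by simpa using hq.symm)
      have key : ∃ t, u' ++ false :: v = false :: t ∧ b = t ++ q₂ := by
        cases u' with
        | nil => exact ⟨v, rfl, by simpa using h⟩
        | cons x u' =>
          obtain ⟨rfl, rfl⟩ : false = x ∧ _ := by simpa using h
          exact ⟨u' ++ false :: v, rfl, by simp⟩
      obtain ⟨t, ht, rfl⟩ := key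
      refine ⟨false :: (c ++ t), q₂, by simp, ?_, .refl, ?_⟩
      · rw [List.append_assoc, ht]
        exact .single (.swap c t hc)
      · rw [List.append_assoc, ht, hc.append_iff_of_zero, pathFrom_succ_false_cons] at hq₁
        rwa [pathFrom_succ_false_cons, hc.append_iff_of_zero]
  | @cons x v w h ih =>
    cases q₁ with
    | nil => exact ⟨[], x :: v, rfl, .refl, (show x :: w = q₂ from hq) ▸ .single (.cons x h), hq₁⟩
    | cons y q₁ =>
      obtain ⟨rfl, rfl⟩ : x = y ∧ w = q₁ ++ q₂ := by simpa using hq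
      cases x with
      | true =>
        obtain ⟨p₁, p₂, rfl, h₁, h₂, h₃⟩ :=
          ih (pathFrom_true_cons.1 hp) rfl (pathFrom_true_cons.1 hq₁)
        exact ⟨true :: p₁, p₂, rfl, h₁.cons _, h₂, pathFrom_true_cons.2 h₃⟩
      | false =>
        cases j with
        | zero => simp at hp
        | succ j =>
          obtain ⟨p₁, p₂, rfl, h₁, h₂, h₃⟩ :=
            ih (pathFrom_succ_false_cons.1 hp) rfl (pathFrom_succ_false_cons.1 hq₁)
          exact ⟨false :: p₁, p₂, rfl, h₁.cons _, h₂, pathFrom_succ_false_cons.2 h₃⟩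

theorem WordLE.exists_append {j : ℕ} {p q₁ q₂ : List Bool} (h : WordLE m p (q₁ ++ q₂))
    (hp : PathFrom m j p) (hq₁ : PathFrom m j q₁) :
    ∃ p₁ p₂, p = p₁ ++ p₂ ∧ WordLE m p₁ q₁ ∧ WordLE m p₂ q₂ ∧ PathFrom m j p₁ := by
  induction h using Relation.ReflTransGen.head_induction_on with
  | refl => exact ⟨q₁, q₂, rfl, .refl, .refl, hq₁⟩
  | head h _ ih =>
    obtain ⟨p₁, p₂, rfl, h₁, h₂, h₃⟩ := ih (h.pathFrom hp)
    obtain ⟨r₁, r₂, rfl, h₁', h₂', h₃'⟩ := h.exists_append hp rfl h₃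
    exact ⟨r₁, r₂, rfl, h₁'.trans h₁, h₂'.trans h₂, h₃'⟩

/-- Erasing the step `0` that leads to the first visit of level `0` is monotone. -/
theorem Slide.exists_first_visit {j : ℕ} {p q r s : List Bool} (h : Slide m p q)
    (hp : p = r ++ false :: s) (hr : PathFrom m j r) :
    ∃ r' s', q = r' ++ false :: s' ∧ PathFrom m j r' ∧ WordLE m (r ++ s) (r' ++ s') := by
  induction h generalizing j r with
  | swap c b hc =>
    cases r with
    | nil =>
      obtain rfl : c ++ b = s := by simpa using hp
      obtain rfl : j = 0 := by simpa using hr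
      -- The erased step is the one that slides: nothing changes after erasure.
      exact ⟨c, b, rfl, hc, .refl⟩
    | cons x r =>
      obtain ⟨rfl, hp'⟩ : false = x ∧ c ++ b = r ++ false :: s := by simpa using hp
      cases j with
      | zero => simp at hr
      | succ j =>
        -- The erased step goes below relative level `0`, which `c` never does, so it comes after
        -- `c` and the slide survives the erasure.
        obtain ⟨r', rfl, hr', rfl⟩ := hc.exists_eq_append (i := j) (by simpa using hr) hp'.symm
        refine ⟨c ++ false :: r', s, by simp, ?_, ?_⟩
        · rwa [hc.append_iff_of_zero, pathFrom_succ_false_cons]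
        · simpa [WordLE] using Relation.ReflTransGen.single (Slide.swap c (r' ++ s) hc)
  | @cons x v w h ih =>
    cases r with
    | nil =>
      obtain ⟨rfl, rfl⟩ : x = false ∧ v = s := by simpa using hp
      exact ⟨[], w, rfl, hr, .single h⟩
    | cons y r =>
      obtain ⟨rfl, hp'⟩ : x = y ∧ v = r ++ false :: s := by simpa using hp
      cases x with
      | true =>
        obtain ⟨r', s', rfl, hr', h'⟩ := ih hp' (pathFrom_true_cons.1 hr)
        exact ⟨true :: r', s', rfl, pathFrom_true_cons.2 hr', h'.cons _⟩
      | false =>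
        cases j with
        | zero => simp at hr
        | succ j =>
          obtain ⟨r', s', rfl, hr', h'⟩ := ih hp' (pathFrom_succ_false_cons.1 hr)
          exact ⟨false :: r', s', rfl, pathFrom_succ_false_cons.2 hr', h'.cons _⟩

theorem WordLE.exists_first_visit {j : ℕ} {q r s : List Bool}
    (h : WordLE m (r ++ false :: s) q) (hr : PathFrom m j r) :
    ∃ r' s', q = r' ++ false :: s' ∧ PathFrom m j r' ∧ WordLE m (r ++ s) (r' ++ s') := by
  induction h with
  | refl => exact ⟨r, s, rfl, hr, .refl⟩
  | tail _ h ih =>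
    obtain ⟨r₁, s₁, rfl, hr₁, h₁⟩ := ih
    obtain ⟨r₂, s₂, rfl, hr₂, h₂⟩ := h.exists_first_visit rfl hr₁
    exact ⟨r₂, s₂, rfl, hr₂, h₁.trans h₂⟩

/-- Forwards, erase the first-visit step on both sides; it is the last step of `u 0`. Backwards,
slide that step past `s` to the end, then work on the prefix. -/
theorem wordLE_append_false_iff {j : ℕ} {r s u : List Bool} (hr : PathFrom m j r)
    (hs : PathFrom m 0 s) (hu : PathFrom m j u) :
    WordLE m (r ++ false :: s) (u ++ [false]) ↔ WordLE m (r ++ s) u := by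
  constructor
  · intro h
    obtain ⟨r', s', h₁, hr', h₂⟩ := h.exists_first_visit hr
    obtain ⟨rfl, rfl⟩ := hu.first_visit_unique hr' h₁
    simpa using h₂
  · intro h
    have h₁ : WordLE m (r ++ false :: s) (r ++ s ++ [false]) := by
      simpa [WordLE] using Relation.ReflTransGen.single ((Slide.swap s [] hs).append_left r)
    exact h₁.trans (h.append .refl)

end Order

/-! ### Comparison with ballot paths and rotations -/

section Comparison

variable {m : ℕ}

theorem pathFrom_iff {j : ℕ} {w : List Bool} :
    PathFrom m j w ↔ w.count false = j + m * w.count true ∧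
      ∀ k ≤ w.length, (w.take k).count false ≤ j + m * (w.take k).count true := by
  refine ⟨fun h => ⟨h.count_false, ?_⟩, ?_⟩
  · induction w generalizing j with
    | nil => simp
    | cons b w ih =>
      rintro (_ | k) hk
      · simp
      · have hk' : k ≤ w.length := by simpa using hk
        cases b with
        | true =>
          have := ih (pathFrom_true_cons.1 h) k hk'
          simp only [List.take_succ_cons, List.count_cons]
          simp
          lia
        | false =>
          cases j with
          | zero => simp at h
          | succ j =>
            have := ih (pathFrom_succ_false_cons.1 h) k hk'
            simp only [List.take_succ_cons, List.count_cons]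
            simp
            lia
  · induction w generalizing j with
    | nil => simp [eq_comm]
    | cons b w ih =>
      rintro ⟨h₁, h₂⟩
      cases b with
      | true =>
        refine pathFrom_true_cons.2 (ih ⟨?_, fun k hk => ?_⟩)
        · simp only [List.count_cons] at h₁
          simp at h₁
          lia
        · have := h₂ (k + 1) (by simpa using hk)
          simp only [List.take_succ_cons, List.count_cons] at this
          simp at this
          lia
      | false =>
        cases j with
        | zero => simpa using h₂ 1 (by simp)
        | succ j =>
          refine pathFrom_succ_false_cons.2 (ih ⟨?_, fun k hk => ?_⟩)
          · simp only [List.count_cons] at h₁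
            simp at h₁
            lia
          · have := h₂ (k + 1) (by simpa using hk)
            simp only [List.take_succ_cons, List.count_cons] at this
            simp at this
            lia

theorem isBallotPath_iff {n : ℕ} {w : List Bool} :
    IsBallotPath m n w ↔ PathFrom m 0 w ∧ w.count true = n := by
  rw [pathFrom_iff, IsBallotPath]
  constructor
  · rintro ⟨rfl, h₁, h₂⟩
    exact ⟨⟨by simpa using h₁, by simpa using h₂⟩, rfl⟩
  · rintro ⟨⟨h₁, h₂⟩, rfl⟩
    exact ⟨rfl, by simpa using h₁, by simpa using h₂⟩

theorem PathFrom.take_zero {w : List Bool} {k : ℕ} (hw : PathFrom m 0 w)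
    (hk : TouchesAt m w k) : PathFrom m 0 (w.take k) := by
  rw [pathFrom_iff] at hw ⊢
  refine ⟨by simpa [TouchesAt] using hk, fun i hi => ?_⟩
  rw [List.take_take]
  rw [List.length_take] at hi
  exact hw.2 _ (by lia)

theorem PathFrom.exists_primitive {c : List Bool} (hc : PathFrom m 0 c) (h : c ≠ []) :
    ∃ c₁ c₂, c = c₁ ++ c₂ ∧ IsPrimitive m c₁ ∧ PathFrom m 0 c₂ := by
  have hlen : 0 < c.length := List.length_pos_iff.2 h
  have hex : ∃ k, 0 < k ∧ TouchesAt m c k :=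
    ⟨c.length, hlen, by simpa [TouchesAt] using hc.count_false⟩
  obtain ⟨k, ⟨hk₀, hk⟩, hmin⟩ : ∃ k, (0 < k ∧ TouchesAt m c k) ∧
      ∀ i < k, ¬ (0 < i ∧ TouchesAt m c i) :=
    ⟨Nat.find hex, Nat.find_spec hex, fun i hi => Nat.find_min hex hi⟩
  have hpath := hc.take_zero hk
  refine ⟨c.take k, c.drop k, (List.take_append_drop k c).symm, ⟨?_, ?_, ?_⟩, ?_⟩
  · rw [Ne, List.take_eq_nil_iff]
    exact fun h' => h'.elim (by lia) h
  · exact ⟨_, isBallotPath_iff.2 ⟨hpath, rfl⟩⟩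
  · intro i hi hi' ht
    rw [List.length_take] at hi'
    refine hmin i (by lia) ⟨hi, ?_⟩
    rwa [TouchesAt, List.take_take, min_eq_left (by lia)] at ht
  · rwa [← hpath.append_zero_iff, List.take_append_drop]

/-- A rotation of words. -/
def WordRotation (m : ℕ) (v w : List Bool) : Prop :=
  ∃ a c b : List Bool, IsPrimitive m c ∧ v = a ++ [false] ++ c ++ b ∧ w = a ++ c ++ [false] ++ b

theorem WordRotation.slide {v w : List Bool} (h : WordRotation m v w) : Slide m v w := by
  obtain ⟨a, c, b, ⟨-, ⟨n, hc⟩, -⟩, rfl, rfl⟩ := h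
  simpa using (Slide.swap c b (isBallotPath_iff.1 hc).1).append_left a

/-- A ballot path is a concatenation of primitive ones, and the step `0` passes them one at a time.
-/
theorem Slide.reflTransGen_wordRotation {v w : List Bool} (h : Slide m v w) :
    Relation.ReflTransGen (WordRotation m) v w := by
  obtain ⟨a, c, b, hc, rfl, rfl⟩ := h.exists_eq
  clear h
  induction hn : c.length using Nat.strong_induction_on generalizing a c with
  | _ n ih =>
    rcases eq_or_ne c [] with rfl | hne
    · simpa using Relation.ReflTransGen.refl
    · obtain ⟨c₁, c₂, rfl, h₁, h₂⟩ := hc.exists_primitive hne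
      have hpos := List.length_pos_iff.2 h₁.1
      rw [List.length_append] at hn
      have hrot : WordRotation m (a ++ [false] ++ (c₁ ++ c₂) ++ b)
          ((a ++ c₁) ++ [false] ++ c₂ ++ b) := ⟨a, c₁, c₂ ++ b, h₁, by simp, by simp⟩
      refine .head hrot ?_
      simpa using ih c₂.length (by lia) (a ++ c₁) c₂ h₂ rfl

theorem wordLE_iff_reflTransGen {v w : List Bool} :
    WordLE m v w ↔ Relation.ReflTransGen (WordRotation m) v w := by
  refine ⟨fun h => ?_, Relation.ReflTransGen.mono (fun _ _ => WordRotation.slide) _ _⟩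
  induction h with
  | refl => exact .refl
  | tail _ h ih => exact ih.trans h.reflTransGen_wordRotation

theorem WordLE.isBallotPath {n : ℕ} {v w : List Bool} (h : WordLE m v w)
    (hv : IsBallotPath m n v) : IsBallotPath m n w := by
  rw [isBallotPath_iff] at hv ⊢
  exact ⟨h.pathFrom hv.1, by rw [← hv.2, h.perm.count_eq]⟩

theorem BallotPath.le_iff {n : ℕ} {p q : BallotPath m n} : p ≤ q ↔ WordLE m p.1 q.1 := by
  rw [wordLE_iff_reflTransGen]
  constructor
  · intro h
    exact Relation.ReflTransGen.lift (r := Rotation) (p := WordRotation m)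
      (fun p : BallotPath m n => p.1) (fun _ _ h => h) _ _ h
  · obtain ⟨p, hp⟩ := p
    suffices ∀ w, Relation.ReflTransGen (WordRotation m) p w →
        ∃ hw : IsBallotPath m n w,
          Relation.ReflTransGen Rotation (⟨p, hp⟩ : BallotPath m n) ⟨w, hw⟩ from
      fun h => (this _ h).2
    intro w h
    induction h with
    | refl => exact ⟨hp, .refl⟩
    | tail _ h ih =>
      obtain ⟨hv, ih⟩ := ih
      exact ⟨WordLE.isBallotPath (.single h.slide) hv, ih.tail h⟩

theorem PathFrom.sum_touches {j : ℕ} {w : List Bool} (h : PathFrom m j w) :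
    (∑ k ∈ Finset.range w.length,
      if (w.take k).count false = j + m * (w.take k).count true then 1 else 0) =
      levelContacts m j w := by
  induction w generalizing j with
  | nil => simp [levelContacts]
  | cons b w ih =>
    rw [List.length_cons, Finset.sum_range_succ']
    cases b with
    | true =>
      rw [levelContacts, ← ih (pathFrom_true_cons.1 h), add_comm]
      congr 1
      · simp [eq_comm]
      · refine Finset.sum_congr rfl fun k _ => if_congr ?_ rfl rfl
        simp only [List.take_succ_cons, List.count_cons]
        simp
        lia
    | false =>
      cases j with
      | zero => simp at h
      | succ j =>
        rw [levelContacts, Nat.add_sub_cancel, ← ih (pathFrom_succ_false_cons.1 h), add_comm]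
        congr 1
        refine Finset.sum_congr rfl fun k _ => if_congr ?_ rfl rfl
        simp only [List.take_succ_cons, List.count_cons]
        simp
        lia

/-- `contacts` omits the origin and `levelContacts` the last point; both points are on the line, so
the counts agree. -/
theorem PathFrom.contacts_eq {w : List Bool} (h : PathFrom m 0 w) :
    contacts m w = levelContacts m 0 w := by
  have h₁ : (∑ k ∈ Finset.range w.length, if TouchesAt m w k then 1 else 0) =
      levelContacts m 0 w := by
    rw [← h.sum_touches]
    exact Finset.sum_congr rfl fun k _ => if_congr (by simp [TouchesAt]) rfl rfl
  have h₂ := Finset.sum_range_succ' (fun k => if TouchesAt m w k then 1 else 0) w.length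
  rw [Finset.sum_range_succ, h₁, if_pos (by simpa [TouchesAt] using h.count_false),
    if_pos (by simp [TouchesAt]), add_left_inj] at h₂
  rw [contacts, Finset.card_filter, ← Finset.Ico_add_one_right_eq_Icc,
    Finset.sum_Ico_eq_sum_range, h₂]
  simp [add_comm 1]

end Comparison

/-! ### Series of intervals from a given level -/

theorem finite_levelIntervals (m j n : ℕ) :
    {p : List Bool × List Bool | PathFrom m j p.1 ∧ PathFrom m j p.2 ∧
      p.1.count true = n ∧ WordLE m p.1 p.2}.Finite := by
  have h := List.finite_length_eq Bool (n + (j + m * n))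
  refine (h.prod h).subset ?_
  rintro ⟨v, w⟩ ⟨hv, -, rfl, hvw⟩
  have hlen : v.length = v.count true + (j + m * v.count true) := by
    rw [← hv.count_false, List.count_true_add_count_false]
  exact ⟨hlen, hvw.perm.length_eq.symm.trans hlen⟩

/-- The pairs `v ≤ w` of paths from level `j` with `n` up steps. -/
noncomputable def levelIntervals (m j n : ℕ) : Finset (List Bool × List Bool) :=
  (finite_levelIntervals m j n).toFinset

/-- The generating function of the pairs `v ≤ w` of paths from level `j`. -/
noncomputable def levelSeries (m j : ℕ) : Series :=
  PowerSeries.mk fun n => ∑ p ∈ levelIntervals m j n, Polynomial.X ^ levelContacts m j p.1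

section Series

variable {m : ℕ}

theorem mem_levelIntervals {j n : ℕ} {p : List Bool × List Bool} :
    p ∈ levelIntervals m j n ↔ PathFrom m j p.1 ∧ PathFrom m j p.2 ∧
      p.1.count true = n ∧ WordLE m p.1 p.2 := by
  simp [levelIntervals]

theorem intervalSeries_eq_levelSeries : intervalSeries m = levelSeries m 0 := by
  ext1 n
  rw [intervalSeries, levelSeries, PowerSeries.coeff_mk, PowerSeries.coeff_mk]
  refine Finset.sum_bij (fun I _ => (I.1.1.1, I.1.2.1)) ?_ ?_ ?_ ?_
  · rintro ⟨⟨⟨v, hv⟩, ⟨w, hw⟩⟩, h⟩ -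
    rw [mem_levelIntervals]
    rw [isBallotPath_iff] at hv hw
    exact ⟨hv.1, hw.1, hv.2, BallotPath.le_iff.1 h⟩
  · rintro I - J - h
    rw [Prod.mk.injEq] at h
    exact Subtype.ext (Prod.ext (Subtype.ext h.1) (Subtype.ext h.2))
  · rintro ⟨v, w⟩ h
    obtain ⟨hv, hw, hn, hvw⟩ := mem_levelIntervals.1 h
    have hv' : IsBallotPath m n v := isBallotPath_iff.2 ⟨hv, hn⟩
    exact ⟨⟨(⟨v, hv'⟩, ⟨w, hvw.isBallotPath hv'⟩), BallotPath.le_iff.2 hvw⟩,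
      Finset.mem_univ _, rfl⟩
  · rintro ⟨⟨⟨v, hv⟩, ⟨w, hw⟩⟩, h⟩ -
    rw [(isBallotPath_iff.1 hv).1.contacts_eq]

theorem levelIntervals_zero_zero : levelIntervals m 0 0 = {([], [])} := by
  ext ⟨v, w⟩
  rw [mem_levelIntervals, Finset.mem_singleton]
  constructor
  · rintro ⟨hv, -, hn, hvw⟩
    have hv' : v = [] := by
      rw [← List.length_eq_zero_iff, ← List.count_true_add_count_false (l := v), hv.count_false]
      dsimp only at hn
      simp [hn]
    subst hv'
    rw [Prod.mk.injEq]
    exact ⟨rfl, hvw.perm.nil_eq.symm⟩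
  · rintro h
    obtain ⟨rfl, rfl⟩ : v = [] ∧ w = [] := by simpa using h
    exact ⟨by simp, by simp, by simp, .refl⟩

theorem levelSeries_zero : levelSeries m 0 = x * y * levelSeries m m + 1 := by
  ext1 n
  rw [x, y, mul_assoc, map_add, PowerSeries.coeff_C_mul]
  cases n with
  | zero =>
    simp [levelSeries, levelIntervals_zero_zero, levelContacts]
  | succ n =>
    rw [PowerSeries.coeff_succ_X_mul, levelSeries, levelSeries, PowerSeries.coeff_mk,
      PowerSeries.coeff_mk, Finset.mul_sum, PowerSeries.coeff_one, if_neg n.succ_ne_zero, add_zero]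
    symm
    refine Finset.sum_nbij (fun p => (true :: p.1, true :: p.2)) ?_ ?_ ?_ ?_
    · intro p hp
      obtain ⟨hv, hw, hn, hvw⟩ := mem_levelIntervals.1 hp
      exact mem_levelIntervals.2 ⟨by simpa using hv, by simpa using hw, by simpa using hn,
        hvw.cons _⟩
    · intro p _ q _ h
      simpa [Prod.ext_iff] using h
    · rintro ⟨v, w⟩ h
      obtain ⟨hv, hw, hn, hvw⟩ := mem_levelIntervals.1 h
      match v with
      | [] => simp at hn
      | false :: v => simp at hv
      | true :: v =>
        obtain ⟨w, rfl, hvw'⟩ := hvw.exists_of_true_cons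
        refine ⟨(v, w), mem_levelIntervals.2 ⟨?_, ?_, ?_, hvw'⟩, rfl⟩
        · simpa using hv
        · simpa using hw
        · simpa using hn
    · intro p _
      simp [levelContacts, pow_add]

/-! ### Divided differences as sums over marked visits of level `0` -/

theorem polyDelta_sum {ι : Type*} (s : Finset ι) (f : ι → Polynomial ℤ) :
    polyDelta (∑ i ∈ s, f i) = ∑ i ∈ s, polyDelta (f i) :=
  map_sum (AddMonoidHom.mk' polyDelta polyDelta_add) f s

theorem polyDelta_X_pow (c : ℕ) :
    polyDelta (Polynomial.X ^ c) = ∑ i ∈ Finset.range (c + 1), Polynomial.X ^ i := by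
  have h : (Polynomial.X - 1 : Polynomial ℤ) ≠ 0 := Polynomial.X_sub_C_ne_zero 1
  apply mul_left_cancel₀ h
  rw [sub_one_mul_polyDelta, mul_geom_sum, pow_succ']
  simp

open Classical in
/-- The ways to cut `w` into a path to level `0` and a path from level `0`. -/
noncomputable def cuts (m : ℕ) (w : List Bool) : Finset ℕ :=
  (Finset.range (w.length + 1)).filter fun k => PathFrom m 0 (w.drop k)

theorem mem_cuts {w : List Bool} {k : ℕ} :
    k ∈ cuts m w ↔ k ≤ w.length ∧ PathFrom m 0 (w.drop k) := by
  simp [cuts]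

theorem PathFrom.sum_cuts {j : ℕ} {w : List Bool} (h : PathFrom m j w) :
    ∑ k ∈ cuts m w, (Polynomial.X : Polynomial ℤ) ^ levelContacts m 0 (w.drop k) =
      polyDelta (Polynomial.X ^ levelContacts m j w) := by
  classical
  rw [polyDelta_X_pow, cuts, Finset.sum_filter]
  induction w generalizing j with
  | nil => simp [levelContacts]
  | cons b w ih =>
    rw [List.length_cons, Finset.sum_range_succ']
    simp only [List.drop_succ_cons, List.drop_zero]
    -- The cut before the first step is allowed only at level `0`; it then contributes the top power
    -- of `X`.
    have hj : PathFrom m 0 (b :: w) ↔ j = 0 :=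
      ⟨fun h' => h.level_unique h', fun h' => h' ▸ h⟩
    rw [if_congr hj rfl rfl]
    cases b with
    | true =>
      rw [ih (pathFrom_true_cons.1 h)]
      rcases eq_or_ne j 0 with rfl | hj
      · simp [levelContacts, add_comm 1, Finset.sum_range_succ _ (_ + 1)]
      · simp [levelContacts, hj]
    | false =>
      cases j with
      | zero => simp at h
      | succ j =>
        rw [ih (pathFrom_succ_false_cons.1 h)]
        simp [levelContacts]

theorem coeff_delta_levelSeries (j n : ℕ) :
    PowerSeries.coeff n (delta (levelSeries m j)) = ∑ p ∈ levelIntervals m j n,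
      ∑ k ∈ cuts m p.1, Polynomial.X ^ levelContacts m 0 (p.1.drop k) := by
  rw [delta, levelSeries, PowerSeries.coeff_mk, PowerSeries.coeff_mk, polyDelta_sum]
  exact Finset.sum_congr rfl fun p hp => (mem_levelIntervals.1 hp).1.sum_cuts.symm

/-- The lower path of an interval is `r 0 s t` and the upper path is `u 0 v`, where `r s ≤ u` and
`t ≤ v`; both steps `0` lead to the first visit of level `0`. -/
theorem levelSeries_succ (j : ℕ) :
    levelSeries m (j + 1) = levelSeries m 0 * delta (levelSeries m j) := by
  ext1 n
  -- An index `e` consists of the sizes, the pair `(t, v)`, the pair `(p, u)` with `p = r s`, and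
  -- the position `k` of the cut between `r` and `s`.
  have hsum : PowerSeries.coeff n (levelSeries m 0 * delta (levelSeries m j)) =
      ∑ e ∈ (Finset.HasAntidiagonal.antidiagonal n).sigma fun d => (levelIntervals m 0 d.1).sigma fun _ =>
        (levelIntervals m j d.2).sigma fun p => cuts m p.1,
        Polynomial.X ^ levelContacts m 0 e.2.1.1 *
          Polynomial.X ^ levelContacts m 0 (e.2.2.1.1.drop e.2.2.2) := by
    simp only [PowerSeries.coeff_mul, coeff_delta_levelSeries, Finset.sum_sigma, ← Finset.mul_sum,
      ← Finset.sum_mul]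
    simp only [levelSeries, PowerSeries.coeff_mk]
  rw [hsum, levelSeries, PowerSeries.coeff_mk]
  symm
  refine Finset.sum_nbij
    (fun e => (e.2.2.1.1.take e.2.2.2 ++ false :: (e.2.2.1.1.drop e.2.2.2 ++ e.2.1.1),
      e.2.2.1.2 ++ false :: e.2.1.2)) ?_ ?_ ?_ ?_
  · rintro ⟨⟨a, b⟩, ⟨t, v⟩, ⟨p, u⟩, k⟩ he
    simp only [Finset.mem_sigma, Finset.HasAntidiagonal.mem_antidiagonal, mem_levelIntervals, mem_cuts] at he
    obtain ⟨rfl, ⟨ht, hv, rfl, htv⟩, ⟨hp, hu, rfl, hpu⟩, hk, hs⟩ := he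
    have hr : PathFrom m j (p.take k) := PathFrom.of_append (by rwa [List.take_append_drop]) hs
    refine mem_levelIntervals.2 ⟨?_, hu.append_false hv, ?_, ?_⟩
    · exact hr.append_false (hs.append_zero_iff.2 ht)
    · have := congrArg (List.count true) (List.take_append_drop k p)
      simp only [List.count_append] at this
      simp
      lia
    · have := (wordLE_append_false_iff hr hs hu).2 (by rwa [List.take_append_drop])
      simpa using this.append htv
  · rintro ⟨⟨a, b⟩, ⟨t, v⟩, ⟨p, u⟩, k⟩ he ⟨⟨a', b'⟩, ⟨t', v'⟩, ⟨p', u'⟩, k'⟩ he' h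
    simp only [Finset.mem_coe, Finset.mem_sigma, Finset.HasAntidiagonal.mem_antidiagonal, mem_levelIntervals,
      mem_cuts] at he he'
    obtain ⟨-, ⟨ht, hv, rfl, htv⟩, ⟨hp, hu, rfl, hpu⟩, hk, hs⟩ := he
    obtain ⟨-, ⟨ht', hv', rfl, htv'⟩, ⟨hp', hu', rfl, hpu'⟩, hk', hs'⟩ := he'
    have hr : PathFrom m j (p.take k) := PathFrom.of_append (by rwa [List.take_append_drop]) hs
    have hr' : PathFrom m j (p'.take k') :=
      PathFrom.of_append (by rwa [List.take_append_drop]) hs'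
    obtain ⟨h₁, h₂⟩ := Prod.mk.inj h
    obtain ⟨rfl, rfl⟩ := hu.first_visit_unique hu' h₂
    obtain ⟨h₃, h₄⟩ := hr.first_visit_unique hr' h₁
    have hkk : k = k' := by
      simpa [List.length_take, min_eq_left hk, min_eq_left hk'] using congrArg List.length h₃
    subst hkk
    -- Comparable words have equal length, so the common `u` fixes the length of `r s`; this
    -- separates `s` from `t`.
    have hlen : p.length = p'.length := hpu.perm.length_eq.trans hpu'.perm.length_eq.symm
    obtain ⟨h₅, rfl⟩ := List.append_inj h₄ (by simp [hlen])
    have hpp : p = p' := by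
      rw [← List.take_append_drop k p, h₃, h₅, List.take_append_drop]
    subst hpp
    rfl
  · rintro ⟨p, q⟩ hpq
    obtain ⟨hp, hq, rfl, hle⟩ := mem_levelIntervals.1 hpq
    dsimp only at hp hq hle
    obtain ⟨u, v, rfl, hu, hv⟩ := hq.exists_first_visit
    -- The step `0` is kept with `u`, so that this prefix ends at level `0` and the lower path can
    -- be cut accordingly.
    have hu₀ : PathFrom m (j + 1) (u ++ [false]) := hu.append_false (by simp)
    obtain ⟨p, t, rfl, hpu, htv, hp₁⟩ :=
      WordLE.exists_append (q₁ := u ++ [false]) (q₂ := v) (by simpa using hle) hp hu₀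
    have ht := hp₁.append_zero_iff.1 hp
    obtain ⟨r, s, rfl, hr, hs⟩ := hp₁.exists_first_visit
    rw [wordLE_append_false_iff hr hs hu] at hpu
    refine ⟨⟨(t.count true, (r ++ s).count true), (t, v), (r ++ s, u), r.length⟩, ?_, by simp⟩
    simp only [Finset.mem_coe, Finset.mem_sigma, Finset.HasAntidiagonal.mem_antidiagonal, mem_levelIntervals,
      mem_cuts]
    refine ⟨?_, ⟨ht, hv, trivial, htv⟩, ⟨hr.append_zero_iff.2 hs, hu, trivial, hpu⟩, ?_, ?_⟩
    · simp
      lia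
    · simp
    · simpa using hs
  · rintro ⟨⟨a, b⟩, ⟨t, v⟩, ⟨p, u⟩, k⟩ he
    simp only [Finset.mem_sigma, Finset.HasAntidiagonal.mem_antidiagonal, mem_levelIntervals, mem_cuts] at he
    obtain ⟨-, ⟨ht, -⟩, ⟨hp, -⟩, hk, hs⟩ := he
    have hr : PathFrom m j (p.take k) := PathFrom.of_append (by rwa [List.take_append_drop]) hs
    rw [levelContacts_first_visit hr, levelContacts_append hs, pow_add, mul_comm]

/-- Level `0` already uses one copy of the series, and each further level adds one. -/
theorem iterRightProd_replicate (k : ℕ) :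
    iterRightProd (List.replicate (k + 1) (levelSeries m 0)) = levelSeries m k := by
  induction k with
  | zero => rfl
  | succ k ih =>
    rw [levelSeries_succ, ← ih]
    rfl

end Series

end MTamari

theorem mainTheorem6 (m : ℕ) (hm : 1 ≤ m) :
    MTamari.intervalSeries m =
      MTamari.opB (MTamari.intervalSeries m) (fun _ : Fin m => MTamari.intervalSeries m) + 1 := by
  obtain ⟨k, rfl⟩ : ∃ k, m = k + 1 := ⟨m - 1, by lia⟩
  rw [MTamari.intervalSeries_eq_levelSeries, MTamari.opB, List.ofFn_const,
    MTamari.iterRightProd_replicate, MTamari.leftProd, MTamari.rightProd]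
  -- Only the left side is unfolded, since the interval series also occurs on the right.
  conv_lhs => rw [MTamari.levelSeries_zero, MTamari.levelSeries_succ]
  ring
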